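/- Let $k,\ell\ge 0$ be integers. The descending link $\mathrm{lk}^{QV}_\downarrow(x^k a^\ell)$ of the word $x^k a^\ell$ is the abstract simplicial complex whose vertices are the triples $(m,n,p)$ with $m,n\in\{1,\dots,k\}$, $m\neq n$, and $p\in\{1,\dots,\ell\}$, and in which a nonempty set of vertices $\{(m_1,n_1,p_1),\dots,(m_\alpha,n_\alpha,p_\alpha)\}$ is a simplex if and only if there are no repetitions in the list $m_1,n_1,\dots,m_\alpha,n_\alpha$ and no repetitions in the list $p_1,\dots,p_\alpha$. Proposition. For every integer $n\ge 0$, the descending link $\mathrm{lk}^{QV}_\downarrow(x^k a^\ell)$ is $n$-connected whenever $k\ge 4n+5$ and $\ell\ge 2n+3$. That is, its geometric realization $X$ is nonempty and path-connected, and $\pi_i(X,x_0)$ is trivial for all $1\le i\le n$ and all base points $x_0\in X$. -/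

import Mathlib

/-- The vertex set `D_v` for the word `v = x ^ k a ^ ℓ`: the triples `(m, n, p)` with
`m ≠ n` in `{1, …, k}` and `p` in `{1, …, ℓ}`, both index sets being shifted to start at `0`. -/
abbrev DescendingVertex (k ℓ : ℕ) : Type :=
  {t : Fin k × Fin k × Fin ℓ // t.1 ≠ t.2.1}

namespace DescendingVertex

variable {k ℓ : ℕ}

/-- The position of the left `x`-contact. -/
def left (t : DescendingVertex k ℓ) : Fin k := t.1.1

/-- The position of the right `x`-contact. -/
def right (t : DescendingVertex k ℓ) : Fin k := t.1.2.1

/-- The position of the `a`-contact. -/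
def color (t : DescendingVertex k ℓ) : Fin ℓ := t.1.2.2

end DescendingVertex

/-- The descending link `lk↓^{QV}(x ^ k a ^ ℓ)`: a nonempty finite set
`{(m₁, n₁, p₁), …, (m_α, n_α, p_α)}` of vertices is a simplex if and only if there are no
repetitions in the list `m₁, n₁, …, m_α, n_α` and none in the list `p₁, …, p_α`. -/
def descendingLinkQV (k ℓ : ℕ) : AbstractSimplicialComplex (DescendingVertex k ℓ) where
  faces := {S | S.Nonempty ∧
    (S.val.bind fun t => ({t.left, t.right} : Multiset (Fin k))).Nodup ∧
    (S.val.map DescendingVertex.color).Nodup}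
  isRelLowerSet_faces := by
    rintro S ⟨hS, hx, ha⟩
    refine ⟨hS, fun T hTS hT => ⟨hT, ?_, ?_⟩⟩
    · obtain ⟨u, hu⟩ := Multiset.le_iff_exists_add.1 (Finset.val_le_iff.2 hTS)
      rw [hu, Multiset.add_bind] at hx
      exact Multiset.nodup_of_le (Multiset.le_add_right _ _) hx
    · exact Multiset.nodup_of_le (Multiset.map_le_map (Finset.val_le_iff.2 hTS)) ha
  singleton_mem t := by
    refine ⟨Finset.singleton_nonempty t, ?_, ?_⟩
    · simpa [DescendingVertex.left, DescendingVertex.right] using t.2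
    · simp

/-- The geometric realization of an abstract simplicial complex on a finite vertex set `V`, as a
subset of `V → ℝ` (with the topology induced from the product topology): the points of the
standard simplex (barycentric coordinates) whose support is contained in a simplex of `K`. -/
def AbstractSimplicialComplex.realization {V : Type*} [Fintype V]
    (K : AbstractSimplicialComplex V) : Set (V → ℝ) :=
  {x | x ∈ stdSimplex ℝ V ∧ ∃ s ∈ K.faces, ∀ v, x v ≠ 0 → v ∈ s}

/-- A topological space is `n`-connected if it is nonempty and its homotopy groups (sets, for
`i = 0`) `π_i(X, x)` are trivial for all `i ≤ n` and all base points `x`. Here `π_0(X, x)` is the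
set of path components of `X`, so its triviality is path-connectedness. -/
def IsNConnected (n : ℕ) (X : Type*) [TopologicalSpace X] : Prop :=
  Nonempty X ∧ ∀ i ≤ n, ∀ x : X, Subsingleton (HomotopyGroup.Pi i X x)

/-! Connectivity is treated as a filling property: every map of a sphere of dimension at most `n`,
the empty sphere included, extends over the ball. Both no-repetition conditions can be tested on
pairs of vertices, so the descending link is the flag complex of the graph `Compat`
(`mem_descendingLinkQV_faces`).

A flag complex is the union of the stars of its vertices. The stars of the members of a finite
nonempty set `T` intersect in a cone if one member is compatible with all the others; otherwise they
intersect in the common link of `T` (`biInter_flagStar_of_not_cone`). That link is a complex of the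
same kind on the contacts not used by `T`; at most `2|T|` positions and `|T|` colours are lost. By
induction it is `(n + 1 - |T|)`-connected, and the nerve-type lemma `Conn.biUnion` makes the whole
complex `n`-connected (`conn_vertsIn`). The induction starts with path-connectedness, a direct
argument on the graph (`reachable`).

`Conn.biUnion` reduces to the union of two open sets (`Conn.union`), which is proved by subdividing
the ball into small cubes and extending a map cell by cell inside prescribed carriers. To make stars
open, the realization is replaced by `openRealization`; `Fill.realization` returns to barycentric
coordinates, and `subsingleton_homotopyGroup` passes from fillings to homotopy groups. -/

open Set Metric Topology

/-! ### Sphere filling as a form of connectivity -/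

section Fill
variable {X : Type*} [TopologicalSpace X] {ι : Type} [Fintype ι]

/-- Every continuous map from the unit sphere of `ι → ℝ` (with the sup norm) to `Y` extends to a
continuous map from the closed unit ball to `Y`. -/
def Fill (ι : Type) [Fintype ι] (Y : Set X) : Prop :=
  ∀ f : (ι → ℝ) → X, ContinuousOn f (sphere 0 1) → MapsTo f (sphere 0 1) Y →
    ∃ g : (ι → ℝ) → X, ContinuousOn g (closedBall 0 1) ∧ MapsTo g (closedBall 0 1) Y ∧
      EqOn g f (sphere 0 1)

/-- All spheres of dimension at most `n - 2` in `Y` can be filled; so `Conn (n + 2) Y` means that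
`Y` is `n`-connected. -/
def Conn (n : ℕ) (Y : Set X) : Prop :=
  ∀ (ι : Type) [Fintype ι], Fintype.card ι < n → Fill ι Y

theorem Conn.mono {m n : ℕ} {Y : Set X} (h : Conn n Y) (hmn : m ≤ n) : Conn m Y :=
  fun ι _ hι => h ι (hι.trans_le hmn)

theorem conn_zero (Y : Set X) : Conn 0 Y := fun _ _ h => absurd h (Nat.not_lt_zero _)

theorem fill_singleton (x : X) : Fill ι ({x} : Set X) := fun _ _ hf =>
  ⟨fun _ => x, continuousOn_const, fun _ _ => rfl, fun _ hy => (hf hy).symm⟩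

/-- In dimension zero the sphere is empty and the ball is a point, so a filling of the empty map is
a point of `Y`. -/
theorem Conn.nonempty {n : ℕ} {Y : Set X} (h : Conn (n + 1) Y) [Nonempty X] : Y.Nonempty := by
  obtain ⟨x⟩ := ‹Nonempty X›
  have h0 : sphere (0 : Empty → ℝ) 1 = ∅ := by
    ext y
    simp [Subsingleton.elim y 0]
  obtain ⟨g, -, hg, -⟩ := h Empty (by simp) (fun _ => x) continuousOn_const
    (h0 ▸ mapsTo_empty _ _)
  exact ⟨g 0, hg (by simp)⟩

theorem fill_of_isEmpty [IsEmpty ι] {Y : Set X} (h : Y.Nonempty) : Fill ι Y := by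
  obtain ⟨x, hx⟩ := h
  refine fun f _ _ => ⟨fun _ => x, continuousOn_const, fun _ _ => hx, fun y hy => ?_⟩
  simp [Subsingleton.elim y 0] at hy

/-- A sphere that is homotopic in `Y` to a fillable one is fillable. -/
theorem exists_fill_of_homotopy {Y : Set X} {f g₁ : (ι → ℝ) → X} {H : ℝ × (ι → ℝ) → X}
    (hH : ContinuousOn H (Icc 0 1 ×ˢ sphere 0 1)) (hHY : MapsTo H (Icc 0 1 ×ˢ sphere 0 1) Y)
    (h0 : ∀ x ∈ sphere (0 : ι → ℝ) 1, H (0, x) = f x)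
    (hg : ContinuousOn g₁ (closedBall 0 1)) (hgY : MapsTo g₁ (closedBall 0 1) Y)
    (h1 : ∀ x ∈ sphere (0 : ι → ℝ) 1, H (1, x) = g₁ x) :
    ∃ g : (ι → ℝ) → X, ContinuousOn g (closedBall 0 1) ∧ MapsTo g (closedBall 0 1) Y ∧
      EqOn g f (sphere 0 1) := by
  classical
  have hM : ∀ x : ι → ℝ, 1 / 2 ≤ ‖x‖ → ‖x‖ ≤ 1 →
      (2 - 2 * ‖x‖, ‖x‖⁻¹ • x) ∈ Icc (0 : ℝ) 1 ×ˢ sphere (0 : ι → ℝ) 1 := by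
    intro x hx hx1
    have : ‖x‖ ≠ 0 := by linarith
    refine ⟨⟨by dsimp only; linarith, by dsimp only; linarith⟩, ?_⟩
    simp [norm_smul, this]
  have hD : ∀ x : ι → ℝ, ‖x‖ ≤ 1 / 2 → (2 : ℝ) • x ∈ closedBall (0 : ι → ℝ) 1 := by
    intro x hx
    rw [mem_closedBall_zero_iff, norm_smul, Real.norm_ofNat]
    linarith
  -- The inner half of the ball carries a rescaled `g₁`; the outer shell runs the homotopy radially,
  -- from time 1 at radius 1/2 to time 0 on the sphere.
  let g : (ι → ℝ) → X := fun x =>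
    if ‖x‖ ≤ 1 / 2 then g₁ ((2 : ℝ) • x) else H (2 - 2 * ‖x‖, ‖x‖⁻¹ • x)
  have e1 : EqOn g (fun x => g₁ ((2 : ℝ) • x)) {x | ‖x‖ ≤ 1 / 2} := fun x hx => if_pos hx
  have e2 : EqOn g (fun x => H (2 - 2 * ‖x‖, ‖x‖⁻¹ • x)) {x | 1 / 2 ≤ ‖x‖ ∧ ‖x‖ ≤ 1} := by
    rintro x ⟨hx, hx1⟩
    by_cases h : ‖x‖ ≤ 1 / 2
    · have hx2 : ‖x‖ = 1 / 2 := le_antisymm h hx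
      have hs := (hM x hx hx1).2
      have : (2 : ℝ) - 2 * ‖x‖ = 1 := by rw [hx2]; norm_num
      simp only [g, if_pos h, this]
      rw [h1 _ hs, hx2]
      norm_num
    · exact if_neg h
  have hU : closedBall (0 : ι → ℝ) 1 ⊆ {x | ‖x‖ ≤ 1 / 2} ∪ {x | 1 / 2 ≤ ‖x‖ ∧ ‖x‖ ≤ 1} := by
    intro x hx
    rw [mem_closedBall_zero_iff] at hx
    rcases le_total ‖x‖ (1 / 2) with h | h
    · exact Or.inl h
    · exact Or.inr ⟨h, hx⟩
  refine ⟨g, ContinuousOn.mono ?_ hU, ?_, ?_⟩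
  · refine ContinuousOn.union_of_isClosed (ContinuousOn.congr ?_ e1) (ContinuousOn.congr ?_ e2)
      (isClosed_le continuous_norm continuous_const)
      ((isClosed_le continuous_const continuous_norm).inter
        (isClosed_le continuous_norm continuous_const))
    · exact hg.comp (by fun_prop) hD
    · refine hH.comp (ContinuousOn.prodMk (by fun_prop) ?_) fun x hx => hM x hx.1 hx.2
      refine ContinuousOn.smul (continuous_norm.continuousOn.inv₀ ?_) continuousOn_id
      rintro x ⟨hx, -⟩
      linarith
  · intro x hx
    rcases hU hx with h | h
    · rw [e1 h]
      exact hgY (hD x h)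
    · rw [e2 h]
      exact hHY (hM x h.1 h.2)
  · intro x hx
    have hx1 : ‖x‖ = 1 := by simpa using hx
    rw [e2 (show _ ∧ _ by rw [hx1]; norm_num)]
    simp [hx1, h0 x hx]

end Fill

/-! ### The cubical grid and extension cell by cell -/

section Cells
variable {ι : Type}

/-- The closed cell with centre `c` of the cubical decomposition of `ι → ℝ` with vertices in
`2ℤ`: it extends in the directions `i` with `c i` odd. -/
def gridCell (c : ι → ℤ) : Set (ι → ℝ) := {x | ∀ i, |x i - c i| ≤ ((c i % 2 : ℤ) : ℝ)}

/-- The relative boundary of a cell. -/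
def gridCellBoundary (c : ι → ℤ) : Set (ι → ℝ) :=
  {x | x ∈ gridCell c ∧ ∃ i, c i % 2 = 1 ∧ |x i - c i| = 1}

/-- `b` is (the centre of) a face of the cell with centre `c`. -/
def IsGridFace (b c : ι → ℤ) : Prop := ∀ i, |b i - c i| ≤ c i % 2

theorem isClosed_gridCell (c : ι → ℤ) : IsClosed (gridCell c) := by
  simp only [gridCell, ofPred_forall]
  exact isClosed_iInter fun i => isClosed_le (by fun_prop) continuous_const

theorem IsGridFace.even_or_eq {b c : ι → ℤ} (h : IsGridFace b c) (i : ι) :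
    (b i % 2 = 0 ∧ c i % 2 = 1 ∧ (b i = c i + 1 ∨ b i = c i - 1)) ∨ b i = c i := by
  have := abs_le.1 (h i)
  omega

theorem IsGridFace.subset {b c : ι → ℤ} (h : IsGridFace b c) : gridCell b ⊆ gridCell c := by
  intro x hx i
  rcases h.even_or_eq i with ⟨h0, h1, h2⟩ | h2
  · have hxi := hx i
    rw [h0, Int.cast_zero, abs_nonpos_iff, sub_eq_zero] at hxi
    rw [h1, hxi]
    rcases h2 with h2 | h2 <;> rw [h2] <;> simp
  · rw [← h2]
    exact hx i

/-- Relative interiors of cells cover the space: each coordinate is an even integer or lies strictly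
between two consecutive ones. -/
theorem exists_mem_gridCell (x : ι → ℝ) :
    ∃ c : ι → ℤ, x ∈ gridCell c ∧ x ∉ gridCellBoundary c := by
  have key : ∀ t : ℝ, ∃ a : ℤ, |t - a| ≤ ((a % 2 : ℤ) : ℝ) ∧ ¬(a % 2 = 1 ∧ |t - a| = 1) := by
    intro t
    have h1 := Int.floor_le (t / 2)
    have h2 := Int.lt_floor_add_one (t / 2)
    by_cases h : t = 2 * ⌊t / 2⌋
    · refine ⟨2 * ⌊t / 2⌋, ?_, by omega⟩
      push_cast
      rw [← h]
      simp
    · have h3 : (2 * ⌊t / 2⌋ : ℝ) < t := lt_of_le_of_ne (by linarith) (Ne.symm h)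
      have h4 : |t - ((2 * ⌊t / 2⌋ + 1 : ℤ) : ℝ)| < 1 := by
        rw [abs_lt]
        push_cast
        constructor <;> linarith
      refine ⟨2 * ⌊t / 2⌋ + 1, ?_, fun h5 => h4.ne h5.2⟩
      rw [show (2 * ⌊t / 2⌋ + 1) % 2 = 1 by omega]
      exact_mod_cast h4.le
  choose c hc hc' using fun i => key (x i)
  exact ⟨c, hc, fun h => h.2.elim fun i hi => hc' i hi⟩

/-- A cell that meets the relative interior of `b` contains `b`. -/
theorem isGridFace_of_mem {b c : ι → ℤ} {x : ι → ℝ} (hb : x ∈ gridCell b)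
    (hb' : x ∉ gridCellBoundary b) (hc : x ∈ gridCell c) : IsGridFace b c := by
  intro i
  have h1 := hb i
  have h2 := hc i
  have h3 : b i % 2 = 1 → |x i - b i| < 1 := by
    intro h
    rw [h, Int.cast_one] at h1
    exact lt_of_le_of_ne h1 fun h4 => hb' ⟨hb, i, h, h4⟩
  rcases Int.emod_two_eq_zero_or_one (b i) with h0 | h0
  · rw [h0, Int.cast_zero, abs_nonpos_iff, sub_eq_zero] at h1
    rw [h1] at h2
    exact_mod_cast h2
  · have h4 := abs_lt.1 (h3 h0)
    have h5 := abs_le.1 h2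
    have h6 : ((b i - 1 - c i % 2 : ℤ) : ℝ) < c i := by push_cast at *; linarith
    have h7 : (c i : ℝ) < ((b i + 1 + c i % 2 : ℤ) : ℝ) := by push_cast at *; linarith
    rw [Int.cast_lt] at h6 h7
    rw [abs_le]
    omega

/-- A boundary point lies in a proper face. -/
theorem exists_isGridFace_of_mem_boundary {c : ι → ℤ} {x : ι → ℝ}
    (hx : x ∈ gridCellBoundary c) : ∃ b, IsGridFace b c ∧ b ≠ c ∧ x ∈ gridCell b := by
  obtain ⟨b, hb, hb'⟩ := exists_mem_gridCell x
  refine ⟨b, isGridFace_of_mem hb hb' hx.1, ?_, hb⟩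
  rintro rfl
  exact hb' hx

open Classical in
/-- The dimension of a cell. -/
noncomputable def gridDim [Fintype ι] (c : ι → ℤ) : ℕ := Fintype.card {i // c i % 2 = 1}

/-- Passing to a face can turn odd coordinates even, never the reverse, and a proper face does so at
least once. -/
theorem IsGridFace.gridDim_lt [Fintype ι] {b c : ι → ℤ} (h : IsGridFace b c) (hne : b ≠ c) :
    gridDim b < gridDim c := by
  classical
  obtain ⟨i, hi⟩ := Function.ne_iff.1 hne
  have hi1 : b i % 2 = 0 ∧ c i % 2 = 1 := by
    rcases h.even_or_eq i with h | h
    · exact ⟨h.1, h.2.1⟩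
    · exact absurd h hi
  refine Fintype.card_lt_of_injective_of_notMem
    (Subtype.map id fun j (hj : b j % 2 = 1) => ?_) (Subtype.map_injective _ Function.injective_id)
    (b := ⟨i, hi1.2⟩) ?_
  · rcases h.even_or_eq j with h | h
    · exact h.2.1
    · rwa [id, ← h]
  · rintro ⟨⟨j, hj⟩, hji⟩
    have : j = i := congrArg Subtype.val hji
    subst this
    omega

theorem mem_unit_sphere_pi {κ : Type*} [Fintype κ] {y : κ → ℝ} :
    y ∈ sphere (0 : κ → ℝ) 1 ↔ (∀ j, |y j| ≤ 1) ∧ ∃ j, |y j| = 1 := by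
  rw [mem_sphere_zero_iff_norm]
  constructor
  · intro h
    have h1 : ∀ j, |y j| ≤ 1 := fun j => h ▸ norm_le_pi_norm y j
    refine ⟨h1, ?_⟩
    by_contra! hne
    exact ((pi_norm_lt_iff one_pos).2 fun j => lt_of_le_of_ne (h1 j) (hne j)).ne h
  · rintro ⟨h, j, hj⟩
    exact le_antisymm ((pi_norm_le_iff_of_nonneg zero_le_one).2 h) (hj ▸ norm_le_pi_norm y j)

/-- In the sup norm a cell is a translate of the unit ball in its odd coordinates; `φ` and `ψ` are
the two identifications. -/
theorem exists_extension_gridCell {X : Type*} [TopologicalSpace X] {Y : Set X} (c : ι → ℤ)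
    [Fintype {i // c i % 2 = 1}] (hY : Fill {i // c i % 2 = 1} Y)
    {f : (ι → ℝ) → X} (hf : ContinuousOn f (gridCellBoundary c))
    (hfY : MapsTo f (gridCellBoundary c) Y) :
    ∃ g : (ι → ℝ) → X, ContinuousOn g (gridCell c) ∧ MapsTo g (gridCell c) Y ∧
      EqOn g f (gridCellBoundary c) := by
  classical
  let φ : ({i // c i % 2 = 1} → ℝ) → ι → ℝ := fun y i =>
    c i + if h : c i % 2 = 1 then y ⟨i, h⟩ else 0
  let ψ : (ι → ℝ) → {i // c i % 2 = 1} → ℝ := fun x j => x j - c j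
  have hφc : Continuous φ := by
    refine continuous_pi fun i => continuous_const.add ?_
    split_ifs
    · fun_prop
    · fun_prop
  have hψc : Continuous ψ := by fun_prop
  have hφψ : ∀ x ∈ gridCell c, φ (ψ x) = x := by
    intro x hx
    funext i
    by_cases h : c i % 2 = 1
    · simp [φ, ψ, h]
    · have hxi := hx i
      rw [show c i % 2 = 0 by omega, Int.cast_zero, abs_nonpos_iff, sub_eq_zero] at hxi
      simp [φ, h, hxi]
  have hψb : MapsTo ψ (gridCell c) (closedBall 0 1) := by
    intro x hx
    rw [mem_closedBall_zero_iff]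
    refine (pi_norm_le_iff_of_nonneg zero_le_one).2 fun j => ?_
    simpa [j.2] using hx j
  have hψs : MapsTo ψ (gridCellBoundary c) (sphere 0 1) := by
    rintro x ⟨hx, i, hi, hxi⟩
    exact mem_unit_sphere_pi.2 ⟨fun j => by simpa [j.2] using hx j, ⟨i, hi⟩, hxi⟩
  have hφs : MapsTo φ (sphere 0 1) (gridCellBoundary c) := by
    intro y hy
    obtain ⟨h1, ⟨i, hi⟩, h2⟩ := mem_unit_sphere_pi.1 hy
    refine ⟨fun j => ?_, i, hi, by simpa [φ, hi] using h2⟩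
    by_cases h : c j % 2 = 1
    · simpa [φ, h] using h1 ⟨j, h⟩
    · simp only [φ, h, dite_false, add_zero, sub_self, abs_zero]
      exact_mod_cast Int.emod_nonneg (c j) two_ne_zero
  obtain ⟨g, hg, hgY, hgf⟩ := hY (f ∘ φ) (hf.comp hφc.continuousOn hφs) (hfY.comp hφs)
  refine ⟨g ∘ ψ, hg.comp hψc.continuousOn hψb, hgY.comp hψb, fun x hx => ?_⟩
  rw [Function.comp_apply, hgf (hψs hx), Function.comp_apply, hφψ x hx.1]

/-- Extension along a carrier: if the carriers `Φ c` are monotone and can be filled in the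
dimension of `c`, then a map carried by `Φ` extends from a subcomplex. -/
theorem exists_extension_of_carrier [Fintype ι] {X : Type*} [TopologicalSpace X] {Φ : (ι → ℤ) → Set X}
    {K : Finset (ι → ℤ)} (hK : ∀ c ∈ K, ∀ b, IsGridFace b c → b ∈ K)
    (hΦ : ∀ c ∈ K, ∀ b, IsGridFace b c → Φ b ⊆ Φ c)
    (hfill : ∀ c ∈ K, ∀ [Fintype {i // c i % 2 = 1}], Fill {i // c i % 2 = 1} (Φ c))
    (L : Finset (ι → ℤ)) (hLK : L ⊆ K) (hL : ∀ c ∈ L, ∀ b, IsGridFace b c → b ∈ L)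
    (f : (ι → ℝ) → X) (hf : ContinuousOn f (⋃ c ∈ L, gridCell c))
    (hfΦ : ∀ c ∈ L, MapsTo f (gridCell c) (Φ c)) :
    ∃ g : (ι → ℝ) → X, ContinuousOn g (⋃ c ∈ K, gridCell c) ∧
      (∀ c ∈ K, MapsTo g (gridCell c) (Φ c)) ∧ EqOn g f (⋃ c ∈ L, gridCell c) := by
  classical
  induction hn : (K \ L).card generalizing L f with
  | zero =>
    have : L = K := Finset.Subset.antisymm hLK
      (Finset.sdiff_eq_empty_iff_subset.1 (Finset.card_eq_zero.1 hn))
    subst this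
    exact ⟨f, hf, hfΦ, fun _ _ => rfl⟩
  | succ n ih =>
    -- Minimal dimension among the missing cells forces every proper face of `c` to lie in `L`
    -- already, so the map is defined on the whole boundary of `c`.
    obtain ⟨c, hc, hmin⟩ := Finset.exists_min_image (K \ L) gridDim
      (Finset.card_pos.1 (by omega))
    rw [Finset.mem_sdiff] at hc
    have hface : ∀ b, IsGridFace b c → b ≠ c → b ∈ L := by
      intro b hb hne
      by_contra hbL
      exact absurd (hb.gridDim_lt hne)
        (hmin b (Finset.mem_sdiff.2 ⟨hK c hc.1 b hb, hbL⟩)).not_gt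
    have hbL : gridCellBoundary c ⊆ ⋃ c ∈ L, gridCell c := by
      intro x hx
      obtain ⟨b, hb, hne, hxb⟩ := exists_isGridFace_of_mem_boundary hx
      exact mem_biUnion (hface b hb hne) hxb
    -- The old and new domains overlap only in the boundary of `c`: a cell of `L` meeting its
    -- relative interior would have `c` as a face.
    have hLb : ∀ x ∈ gridCell c, x ∈ ⋃ c ∈ L, gridCell c → x ∈ gridCellBoundary c := by
      intro x hx hxL
      by_contra hxb
      obtain ⟨b, hb, hxb'⟩ := mem_iUnion₂.1 hxL
      exact hc.2 (hL b hb c (isGridFace_of_mem hx hxb hxb'))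
    obtain ⟨g, hg, hgΦ, hgf⟩ := exists_extension_gridCell c (hfill c hc.1) (hf.mono hbL) (by
      intro x hx
      obtain ⟨b, hb, hne, hxb⟩ := exists_isGridFace_of_mem_boundary hx
      exact hΦ c hc.1 b hb (hfΦ b (hface b hb hne) hxb))
    let f' : (ι → ℝ) → X := fun x => if x ∈ gridCell c then g x else f x
    have e1 : EqOn f' g (gridCell c) := fun x hx => if_pos hx
    have e2 : EqOn f' f (⋃ c ∈ L, gridCell c) := by
      intro x hx
      by_cases h : x ∈ gridCell c
      · rw [e1 h, hgf (hLb x h hx)]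
      · exact if_neg h
    have hU : ⋃ b ∈ insert c L, gridCell b = gridCell c ∪ ⋃ b ∈ L, gridCell b :=
      Finset.set_biUnion_insert _ _ _
    obtain ⟨g', hg', hgΦ', hgf'⟩ := ih (insert c L) (Finset.insert_subset hc.1 hLK) (by
        intro b hb a ha
        rcases Finset.mem_insert.1 hb with rfl | hb
        · by_cases h : a = b
          · rw [h]
            exact Finset.mem_insert_self _ _
          · exact Finset.mem_insert_of_mem (hface a ha h)
        · exact Finset.mem_insert_of_mem (hL b hb a ha)) f' (by
        rw [hU]
        exact (hg.congr e1).union_of_isClosed (hf.congr e2) (isClosed_gridCell c)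
          (L.finite_toSet.isClosed_biUnion fun b _ => isClosed_gridCell b)) (by
        intro b hb x hx
        rcases Finset.mem_insert.1 hb with rfl | hb
        · rw [e1 hx]
          exact hgΦ hx
        · rw [e2 (mem_biUnion hb hx)]
          exact hfΦ b hb hx) (by
        rw [Finset.sdiff_insert, Finset.card_erase_of_mem (Finset.mem_sdiff.2 hc), hn,
          Nat.add_sub_cancel])
    refine ⟨g', hg', hgΦ', fun x hx => ?_⟩
    rw [hgf' (hU ▸ Or.inr hx), e2 hx]

end Cells

/-! ### Unions of open sets -/

section Gluing
variable {X : Type*} [TopologicalSpace X]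

open Classical in
/-- The cells of the cube `[-m, m] ^ ι`. -/
noncomputable def gridCube (ι : Type) [Fintype ι] (m : ℕ) : Finset (ι → ℤ) :=
  Fintype.piFinset fun _ => Finset.Icc (-(m : ℤ)) m

variable {ι : Type} [Fintype ι]

theorem mem_gridCube {m : ℕ} {c : ι → ℤ} : c ∈ gridCube ι m ↔ ∀ i, |c i| ≤ m := by
  simp [gridCube, abs_le]

theorem IsGridFace.mem_gridCube {m : ℕ} (hm : Even m) {b c : ι → ℤ} (h : IsGridFace b c)
    (hc : c ∈ gridCube ι m) : b ∈ gridCube ι m := by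
  rw [_root_.mem_gridCube] at *
  intro i
  have h1 := abs_le.1 (hc i)
  obtain ⟨k, hk⟩ := hm
  rw [abs_le]
  rcases h.even_or_eq i with h | h <;> omega

/-- Evenness of `m` is essential: an odd centre coordinate is then at most `m - 1` in absolute
value, so its cell does not stick out of the cube. -/
theorem norm_le_of_mem_gridCell {m : ℕ} (hm : Even m) {c : ι → ℤ} (hc : c ∈ gridCube ι m)
    {x : ι → ℝ} (hx : x ∈ gridCell c) : ‖x‖ ≤ m := by
  refine (pi_norm_le_iff_of_nonneg m.cast_nonneg).2 fun i => ?_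
  have h1 := abs_le.1 (mem_gridCube.1 hc i)
  have h2 := abs_le.1 (hx i)
  have h3 : -(m : ℤ) ≤ c i - c i % 2 ∧ c i + c i % 2 ≤ m := by
    obtain ⟨k, hk⟩ := hm
    omega
  have h4 : ((-(m : ℤ) : ℤ) : ℝ) ≤ ((c i - c i % 2 : ℤ) : ℝ) := Int.cast_le.2 h3.1
  have h5 : ((c i + c i % 2 : ℤ) : ℝ) ≤ ((m : ℤ) : ℝ) := Int.cast_le.2 h3.2
  rw [Real.norm_eq_abs, abs_le]
  push_cast at *
  constructor <;> linarith

theorem le_norm_of_mem_gridCell {m : ℕ} (hm : Even m) {c : ι → ℤ} (hc : c ∉ gridCube ι m)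
    {x : ι → ℝ} (hx : x ∈ gridCell c) : (m : ℝ) ≤ ‖x‖ := by
  simp only [mem_gridCube, not_forall, not_le] at hc
  obtain ⟨i, hi⟩ := hc
  refine le_trans ?_ (norm_le_pi_norm x i)
  have h2 := abs_le.1 (hx i)
  obtain ⟨k, hk⟩ := hm
  rw [Real.norm_eq_abs, le_abs]
  rcases lt_abs.1 hi with hi | hi
  · have h3 : (m : ℤ) ≤ c i - c i % 2 := by omega
    have h4 : ((m : ℤ) : ℝ) ≤ ((c i - c i % 2 : ℤ) : ℝ) := Int.cast_le.2 h3
    push_cast at h4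
    left
    linarith
  · have h3 : c i + c i % 2 ≤ - (m : ℤ) := by omega
    have h4 : ((c i + c i % 2 : ℤ) : ℝ) ≤ ((-(m : ℤ) : ℤ) : ℝ) := Int.cast_le.2 h3
    push_cast at h4
    right
    linarith

/-- The last clause places boundary points of the cube in boundary cells, where the map to be
extended is prescribed. -/
theorem exists_mem_gridCube {m : ℕ} (hm : Even m) {x : ι → ℝ} (hx : ‖x‖ ≤ m) :
    ∃ c ∈ gridCube ι m, x ∈ gridCell c ∧ (‖x‖ = m → 0 < m → ∃ i, |c i| = m) := by
  obtain ⟨c, hc, hc'⟩ := exists_mem_gridCell x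
  have hi : ∀ i, |x i| ≤ m := fun i => (norm_le_pi_norm x i).trans hx
  obtain ⟨k, hk⟩ := hm
  have hlt : ∀ i, c i % 2 = 1 → |x i - c i| < 1 := by
    intro i h
    have h1 := hc i
    rw [h, Int.cast_one] at h1
    exact lt_of_le_of_ne h1 fun h4 => hc' ⟨hc, i, h, h4⟩
  have heq : ∀ i, c i % 2 = 0 → x i = c i := by
    intro i h
    have h1 := hc i
    rwa [h, Int.cast_zero, abs_nonpos_iff, sub_eq_zero] at h1
  have hle : ∀ i, |c i| ≤ m := by
    intro i
    rcases Int.emod_two_eq_zero_or_one (c i) with h | h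
    · have := hi i
      rw [heq i h] at this
      exact_mod_cast this
    · have h1 := abs_lt.1 (hlt i h)
      have h2 := abs_le.1 (hi i)
      have h3 : ((-(m : ℤ) - 1 : ℤ) : ℝ) < c i := by push_cast; linarith
      have h4 : (c i : ℝ) < ((m + 1 : ℤ) : ℝ) := by push_cast; linarith
      rw [Int.cast_lt] at h3 h4
      rw [abs_le]
      omega
  refine ⟨c, mem_gridCube.2 hle, hc, fun hxm hm0 => ?_⟩
  have hm0' : (0 : ℝ) < m := Nat.cast_pos.2 hm0
  by_contra! hne
  refine ((pi_norm_lt_iff hm0').2 fun i => ?_).ne hxm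
  rw [Real.norm_eq_abs]
  have h5 := lt_of_le_of_ne (hle i) (hne i)
  rcases Int.emod_two_eq_zero_or_one (c i) with h | h
  · rw [heq i h]
    exact_mod_cast h5
  · have h1 := abs_lt.1 (hlt i h)
    have h6 := abs_lt.1 h5
    have h7 : ((-(m : ℤ) : ℤ) : ℝ) ≤ ((c i - 1 : ℤ) : ℝ) := Int.cast_le.2 (by omega)
    have h8 : ((c i + 1 : ℤ) : ℝ) ≤ ((m : ℤ) : ℝ) := Int.cast_le.2 (by omega)
    push_cast at h7 h8
    rw [abs_lt]
    constructor <;> linarith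

omit [Fintype ι] in
theorem abs_eq_of_isGridFace {m : ℕ} (hm : Even m) {b c : ι → ℤ} (h : IsGridFace b c) {i : ι}
    (hi : |c i| = m) : |b i| = m := by
  obtain ⟨k, hk⟩ := hm
  rcases h.even_or_eq i with h | h
  · rcases abs_choice (c i) with h1 | h1 <;> omega
  · rw [h, hi]

theorem norm_eq_of_mem_gridCell {m : ℕ} (hm : Even m) {c : ι → ℤ} (hc : c ∈ gridCube ι m)
    {i : ι} (hi : |c i| = m) {x : ι → ℝ} (hx : x ∈ gridCell c) : ‖x‖ = m := by
  refine le_antisymm (norm_le_of_mem_gridCell hm hc hx) (le_trans ?_ (norm_le_pi_norm x i))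
  have h1 := hx i
  rw [show c i % 2 = 0 by obtain ⟨k, hk⟩ := hm; rcases abs_choice (c i) with h1 | h1 <;> omega,
    Int.cast_zero, abs_nonpos_iff, sub_eq_zero] at h1
  rw [h1, Real.norm_eq_abs]
  exact_mod_cast hi.ge

theorem dist_le_of_mem_gridCell {c : ι → ℤ} {x y : ι → ℝ} (hx : x ∈ gridCell c)
    (hy : y ∈ gridCell c) : dist x y ≤ 2 := by
  refine (dist_pi_le_iff zero_le_two).2 fun i => ?_
  have h1 : ((c i % 2 : ℤ) : ℝ) ≤ ((1 : ℤ) : ℝ) := Int.cast_le.2 (by omega)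
  rw [Int.cast_one] at h1
  have h2 := abs_le.1 (hx i)
  have h3 := abs_le.1 (hy i)
  rw [Real.dist_eq, abs_le]
  constructor <;> linarith

omit [Fintype ι] in
theorem gridCell_nonempty (c : ι → ℤ) : (gridCell c).Nonempty :=
  ⟨fun i => c i, fun i => by
    rw [sub_self, abs_zero]
    exact_mod_cast Int.emod_nonneg (c i) two_ne_zero⟩

/-- On a fine enough grid, every cell of the annulus is mapped into one of two open sets. -/
theorem exists_fine_grid {A B : Set X} (hA : IsOpen A) (hB : IsOpen B) {h : (ι → ℝ) → X}
    {s : Set (ι → ℝ)} (hs : IsCompact s) (hh : ContinuousOn h s) (hAB : MapsTo h s (A ∪ B)) :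
    ∃ M : ℕ, 0 < M ∧ ∀ c : ι → ℤ, (∀ x ∈ gridCell c, ((4 * M : ℝ)⁻¹) • x ∈ s) →
      (∀ x ∈ gridCell c, h (((4 * M : ℝ)⁻¹) • x) ∈ A) ∨
      (∀ x ∈ gridCell c, h (((4 * M : ℝ)⁻¹) • x) ∈ B) := by
  obtain ⟨u, hu, hus⟩ := continuousOn_iff'.1 hh A hA
  obtain ⟨v, hv, hvs⟩ := continuousOn_iff'.1 hh B hB
  obtain ⟨δ, hδ, H⟩ := lebesgue_number_lemma_of_metric (c := fun b : Bool => cond b u v) hs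
    (by rintro (_ | _) <;> assumption) (by
      intro x hx
      rcases hAB hx with h1 | h1
      · exact mem_iUnion.2 ⟨true, (hus.subset ⟨h1, hx⟩).1⟩
      · exact mem_iUnion.2 ⟨false, (hvs.subset ⟨h1, hx⟩).1⟩)
  -- Cells have diameter at most 2, hence at most `1 / (2 * M) < δ` after scaling by `1 / (4 * M)`.
  obtain ⟨M, hM⟩ := exists_nat_gt (δ⁻¹)
  have hM0 : (0 : ℝ) < M := (inv_pos.2 hδ).trans hM
  refine ⟨M, Nat.cast_pos.1 hM0, fun c hc => ?_⟩
  obtain ⟨y, hy⟩ := gridCell_nonempty c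
  have hball : ∀ x ∈ gridCell c,
      ((4 * M : ℝ)⁻¹) • x ∈ ball (((4 * M : ℝ)⁻¹) • y) δ := by
    intro x hx
    rw [mem_ball, dist_smul₀, Real.norm_eq_abs, abs_of_pos (by positivity)]
    have h1 := dist_le_of_mem_gridCell hx hy
    have h2 : 1 < δ * M := by
      rwa [inv_lt_iff_one_lt_mul₀ hδ, mul_comm] at hM
    rw [inv_mul_lt_iff₀ (by positivity)]
    nlinarith
  obtain ⟨b, hb⟩ := H _ (hc y hy)
  rcases b with _ | _
  · exact Or.inr fun x hx => (hvs.superset ⟨hb (hball x hx), hc x hx⟩).1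
  · exact Or.inl fun x hx => (hus.superset ⟨hb (hball x hx), hc x hx⟩).1

open Classical in
/-- A union of two open sets is as connected as the two sets if the intersection is connected to
one degree less. -/
theorem Conn.union {n : ℕ} {A B : Set X} (hA : IsOpen A) (hB : IsOpen B)
    (cA : Conn (n + 1) A) (cB : Conn (n + 1) B) (cAB : Conn n (A ∩ B)) :
    Conn (n + 1) (A ∪ B) := by
  intro ι _ hι f hf hfAB
  rcases isEmpty_or_nonempty ι with hι0 | ⟨⟨i₀⟩⟩
  · obtain ⟨g, hg, hgA, -⟩ := cA ι hι (fun _ => f 0) continuousOn_const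
      (fun y hy => by simp [Subsingleton.elim y 0] at hy)
    exact ⟨g, hg, fun x hx => Or.inl (hgA hx), fun y hy => by
      simp [Subsingleton.elim y 0] at hy⟩
  obtain ⟨n, rfl⟩ : ∃ m, n = m + 1 := by
    have := Fintype.card_pos_iff.2 ⟨i₀⟩
    exact ⟨n - 1, by omega⟩
  have : Nonempty X := ⟨f 0⟩
  obtain ⟨x₀, hx₀⟩ := cAB.nonempty
  -- The radial extension of `f` to the annulus `s` only serves to choose carriers; the filling need
  -- not agree with it off the sphere.
  let h : (ι → ℝ) → X := fun z => f (‖z‖⁻¹ • z)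
  let s : Set (ι → ℝ) := closedBall 0 1 ∩ {z | 1 / 2 ≤ ‖z‖}
  have hs : IsCompact s := (isCompact_closedBall 0 1).inter_right
    (isClosed_le continuous_const continuous_norm)
  have hs0 : ∀ z ∈ s, ‖z‖ ≠ 0 := fun z hz => by
    have : 1 / 2 ≤ ‖z‖ := hz.2
    linarith
  have hsph : MapsTo (fun z : ι → ℝ => ‖z‖⁻¹ • z) s (sphere 0 1) := fun z hz => by
    simp [norm_smul, hs0 z hz]
  have hh : ContinuousOn h s := hf.comp
    (ContinuousOn.smul (continuous_norm.continuousOn.inv₀ hs0) continuousOn_id) hsph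
  obtain ⟨M, hM, hfine⟩ := exists_fine_grid hA hB hs hh (hfAB.comp hsph)
  have hM0 : (0 : ℝ) < M := Nat.cast_pos.2 hM
  have ev4 : Even (4 * M) := ⟨2 * M, by ring⟩
  have ev2 : Even (2 * M) := ⟨M, by ring⟩
  have hnorm : ∀ x : ι → ℝ, ‖((4 * M : ℝ)⁻¹) • x‖ = ‖x‖ / (4 * M) := fun x => by
    rw [norm_smul, Real.norm_eq_abs, abs_of_pos (by positivity), inv_mul_eq_div]
  have hann : ∀ c ∈ gridCube ι (4 * M), c ∉ gridCube ι (2 * M) →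
      ∀ x ∈ gridCell c, ((4 * M : ℝ)⁻¹) • x ∈ s := by
    intro c hc hc' x hx
    have h1 := norm_le_of_mem_gridCell ev4 hc hx
    have h2 := le_norm_of_mem_gridCell ev2 hc' hx
    push_cast at h1 h2
    refine ⟨?_, ?_⟩
    · rw [mem_closedBall_zero_iff, hnorm, div_le_one (by positivity)]
      exact h1
    · change 1 / 2 ≤ ‖((4 * M : ℝ)⁻¹) • x‖
      rw [hnorm, le_div_iff₀ (by positivity)]
      linarith
  let S : (ι → ℤ) → Set X := fun c => (fun x => h (((4 * M : ℝ)⁻¹) • x)) '' gridCell c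
  have hSmono : ∀ {b c : ι → ℤ}, IsGridFace b c → S b ⊆ S c := fun hbc => image_mono hbc.subset
  have hSAB : ∀ c ∈ gridCube ι (4 * M), c ∉ gridCube ι (2 * M) → S c ⊆ A ∨ S c ⊆ B := by
    intro c hc hc'
    exact (hfine c (hann c hc hc')).imp image_subset_iff.2 image_subset_iff.2
  -- The inner cube is sent to one point of `A ∩ B`. In the annulus the carrier is `A ∩ B` only for
  -- cells below top dimension, since `A ∩ B` is connected to one degree less. Monotonicity survives
  -- because proper faces are never of top dimension.
  let Φ : (ι → ℤ) → Set X := fun c =>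
    if c ∈ gridCube ι (2 * M) then {x₀}
    else if S c ⊆ A ∩ B ∧ ∃ i, c i % 2 = 0 then A ∩ B
    else if S c ⊆ A then A else B
  have hΦ1 : ∀ {c}, c ∈ gridCube ι (2 * M) → Φ c = {x₀} := fun hc => if_pos hc
  have hΦ2 : ∀ {c}, c ∉ gridCube ι (2 * M) → (S c ⊆ A ∩ B ∧ ∃ i, c i % 2 = 0) →
      Φ c = A ∩ B := fun hc h2 => by simp only [Φ, if_neg hc, if_pos h2]
  have hΦ3 : ∀ {c}, c ∉ gridCube ι (2 * M) → ¬(S c ⊆ A ∩ B ∧ ∃ i, c i % 2 = 0) →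
      S c ⊆ A → Φ c = A := fun hc h2 h3 => by simp only [Φ, if_neg hc, if_neg h2, if_pos h3]
  have hΦ4 : ∀ {c}, c ∉ gridCube ι (2 * M) → ¬(S c ⊆ A ∩ B ∧ ∃ i, c i % 2 = 0) →
      ¬S c ⊆ A → Φ c = B := fun hc h2 h3 => by simp only [Φ, if_neg hc, if_neg h2, if_neg h3]
  have hΦsup : ∀ {c}, c ∉ gridCube ι (2 * M) → A ∩ B ⊆ Φ c := by
    intro c hc
    by_cases h2 : S c ⊆ A ∩ B ∧ ∃ i, c i % 2 = 0
    · rw [hΦ2 hc h2]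
    · by_cases h3 : S c ⊆ A
      · rw [hΦ3 hc h2 h3]
        exact inter_subset_left
      · rw [hΦ4 hc h2 h3]
        exact inter_subset_right
  have hΦsub : ∀ c, Φ c ⊆ A ∪ B := by
    intro c
    by_cases hc : c ∈ gridCube ι (2 * M)
    · rw [hΦ1 hc]
      exact singleton_subset_iff.2 (Or.inl hx₀.1)
    · by_cases h2 : S c ⊆ A ∩ B ∧ ∃ i, c i % 2 = 0
      · rw [hΦ2 hc h2]
        exact inter_subset_left.trans subset_union_left
      · by_cases h3 : S c ⊆ A
        · rw [hΦ3 hc h2 h3]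
          exact subset_union_left
        · rw [hΦ4 hc h2 h3]
          exact subset_union_right
  have hSΦ : ∀ c ∈ gridCube ι (4 * M), c ∉ gridCube ι (2 * M) → S c ⊆ Φ c := by
    intro c hc hc'
    by_cases h2 : S c ⊆ A ∩ B ∧ ∃ i, c i % 2 = 0
    · rw [hΦ2 hc' h2]
      exact h2.1
    · by_cases h3 : S c ⊆ A
      · rwa [hΦ3 hc' h2 h3]
      · rw [hΦ4 hc' h2 h3]
        exact (hSAB c hc hc').resolve_left h3
  let L : Finset (ι → ℤ) := (gridCube ι (4 * M)).filter fun c => ∃ i, |c i| = (4 * M : ℕ)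
  have hLs : ∀ c ∈ L, ∀ x ∈ gridCell c, ((4 * M : ℝ)⁻¹) • x ∈ sphere (0 : ι → ℝ) 1 := by
    intro c hc x hx
    obtain ⟨hc, i, hi⟩ := Finset.mem_filter.1 hc
    have := norm_eq_of_mem_gridCell ev4 hc hi hx
    push_cast at this
    rw [mem_sphere_zero_iff_norm, hnorm, this]
    exact div_self (by positivity)
  obtain ⟨g, hg, hgΦ, hgf⟩ := exists_extension_of_carrier (Φ := Φ) (K := gridCube ι (4 * M))
    (fun c hc b hb => hb.mem_gridCube ev4 hc) (by
      intro c hc b hb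
      by_cases hc' : c ∈ gridCube ι (2 * M)
      · rw [hΦ1 hc', hΦ1 (hb.mem_gridCube ev2 hc')]
      by_cases hb' : b ∈ gridCube ι (2 * M)
      · rw [hΦ1 hb', singleton_subset_iff]
        exact hΦsup hc' hx₀
      by_cases hbc : b = c
      · rw [hbc]
      have hev : ∃ i, b i % 2 = 0 := by
        obtain ⟨i, hi⟩ := Function.ne_iff.1 hbc
        exact ⟨i, (hb.even_or_eq i).resolve_right hi |>.1⟩
      by_cases h2 : S b ⊆ A ∩ B
      · rw [hΦ2 hb' ⟨h2, hev⟩]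
        exact hΦsup hc'
      have h2' : ¬ S c ⊆ A ∩ B := fun h => h2 ((hSmono hb).trans h)
      by_cases h3 : S c ⊆ A
      · rw [hΦ3 hc' (fun h => h2' h.1) h3, hΦ3 hb' (fun h => h2 h.1) ((hSmono hb).trans h3)]
      · have h4 := (hSAB c hc hc').resolve_left h3
        have h5 : ¬ S b ⊆ A := fun h => h2 (subset_inter h ((hSmono hb).trans h4))
        rw [hΦ4 hc' (fun h => h2' h.1) h3, hΦ4 hb' (fun h => h2 h.1) h5])
    (by
      intro c hc inst
      have hcard : Fintype.card {i // c i % 2 = 1} ≤ Fintype.card ι :=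
        Fintype.card_le_of_injective _ Subtype.val_injective
      by_cases hc' : c ∈ gridCube ι (2 * M)
      · rw [hΦ1 hc']
        exact fill_singleton x₀
      by_cases h2 : S c ⊆ A ∩ B ∧ ∃ i, c i % 2 = 0
      · rw [hΦ2 hc' h2]
        obtain ⟨i, hi⟩ := h2.2
        have : Fintype.card {i // c i % 2 = 1} < Fintype.card ι :=
          Fintype.card_lt_of_injective_of_notMem (b := i) _ Subtype.val_injective (by
            rintro ⟨⟨j, hj⟩, rfl⟩
            simp only at hi
            omega)
        exact cAB _ (by omega)
      by_cases h3 : S c ⊆ A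
      · rw [hΦ3 hc' h2 h3]
        exact cA _ (by omega)
      · rw [hΦ4 hc' h2 h3]
        exact cB _ (by omega))
    L (Finset.filter_subset _ _) (by
      intro c hc b hb
      obtain ⟨hc, i, hi⟩ := Finset.mem_filter.1 hc
      exact Finset.mem_filter.2 ⟨hb.mem_gridCube ev4 hc, i, abs_eq_of_isGridFace ev4 hb hi⟩)
    (fun x => f (((4 * M : ℝ)⁻¹) • x)) (hf.comp (by fun_prop) (by
      intro x hx
      obtain ⟨c, hc, hxc⟩ := mem_iUnion₂.1 hx
      exact hLs c hc x hxc)) (by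
      intro c hc x hx
      have h1 := hLs c hc x hx
      obtain ⟨hc, i, hi⟩ := Finset.mem_filter.1 hc
      have hc' : c ∉ gridCube ι (2 * M) := fun h => by
        have := mem_gridCube.1 h i
        rw [hi, Nat.cast_le] at this
        omega
      refine hSΦ c hc hc' ⟨x, hx, ?_⟩
      rw [mem_sphere_zero_iff_norm] at h1
      simp only [h, h1, inv_one, one_smul])
  have hcov : ∀ z ∈ closedBall (0 : ι → ℝ) 1, ‖(4 * M : ℝ) • z‖ ≤ (4 * M : ℕ) := by
    intro z hz
    rw [mem_closedBall_zero_iff] at hz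
    rw [norm_smul, Real.norm_eq_abs, abs_of_pos (by positivity)]
    push_cast
    exact mul_le_of_le_one_right (by positivity) hz
  refine ⟨fun z => g ((4 * M : ℝ) • z), hg.comp (by fun_prop) ?_, ?_, ?_⟩
  · intro z hz
    obtain ⟨c, hc, hzc, -⟩ := exists_mem_gridCube ev4 (hcov z hz)
    exact mem_biUnion hc hzc
  · intro z hz
    obtain ⟨c, hc, hzc, -⟩ := exists_mem_gridCube ev4 (hcov z hz)
    exact hΦsub c (hgΦ c hc hzc)
  · intro z hz
    obtain ⟨c, hc, hzc, hc'⟩ := exists_mem_gridCube ev4 (hcov z (sphere_subset_closedBall hz))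
    have hcL : c ∈ L := Finset.mem_filter.2 ⟨hc, hc' (by
      rw [mem_sphere_zero_iff_norm] at hz
      rw [norm_smul, hz, Real.norm_eq_abs, abs_of_pos (by positivity)]
      push_cast
      ring) (by omega)⟩
    have h1 := hgf (mem_biUnion hcL hzc)
    dsimp only at h1 ⊢
    rw [h1, smul_smul, inv_mul_cancel₀ (by positivity), one_smul]

/-- A nerve-type lemma: a finite union of open sets is `n`-connected if all intersections of `t` of
them are `(n + 1 - t)`-connected. -/
theorem Conn.biUnion {α : Type*} [DecidableEq α] {n : ℕ} {U : α → Set X} (hU : ∀ a, IsOpen (U a))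
    {s : Finset α} (hs : s.Nonempty)
    (h : ∀ T ⊆ s, T.Nonempty → Conn (n + 1 - T.card) (⋂ a ∈ T, U a)) :
    Conn n (⋃ a ∈ s, U a) := by
  induction hs using Finset.Nonempty.cons_induction generalizing n U with
  | singleton a => simpa using h {a} subset_rfl (Finset.singleton_nonempty a)
  | cons a s ha hs ih =>
    rw [Finset.cons_eq_insert] at *
    rcases n with _ | n
    · exact conn_zero _
    rw [Finset.set_biUnion_insert]
    refine Conn.union (hU a) (isOpen_biUnion fun b _ => hU b)
      (by simpa using h {a} (by simp) (by simp))
      (ih hU fun T hT hT0 => h T (hT.trans (Finset.subset_insert _ _)) hT0) ?_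
    -- The overlap is the union of the sets `U a ∩ U b`. Adding `a` to an index set raises its
    -- cardinality by one, which matches the degree lost on the overlap.
    rw [inter_iUnion₂]
    refine ih (U := fun b => U a ∩ U b) (fun b => (hU a).inter (hU b)) fun T hT hT0 => ?_
    have h1 := h (insert a T) (Finset.insert_subset_insert _ hT) (Finset.insert_nonempty _ _)
    rw [Finset.card_insert_of_notMem fun h => ha (hT h), Finset.set_biInter_insert] at h1
    have h2 : ⋂ b ∈ T, U a ∩ U b = U a ∩ ⋂ b ∈ T, U b :=
      inter_biInter (Finset.coe_nonempty.2 hT0) U (U a)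
    rw [h2]
    exact h1.mono (by omega)

end Gluing

/-! ### An open model of the realization -/

section OpenRealization
variable {V : Type*}

/-- An open model of the realization of the complex with simplices `K`: the points some coordinate
of which is positive and whose nonnegative coordinates are supported in a simplex. -/
def openRealization (K : Set (Set V)) : Set (V → ℝ) :=
  {x | (∃ v, 0 < x v) ∧ {v | 0 ≤ x v} ∈ K}

/-- Negative coordinates stay negative nearby, so the set of nonnegative coordinates can only shrink
under a small perturbation. -/
theorem isOpen_openRealization [Finite V] {K : Set (Set V)} (hK : IsLowerSet K) :
    IsOpen (openRealization K) := by
  have h1 : IsOpen {x : V → ℝ | ∃ v, 0 < x v} := by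
    simp only [ofPred_exists]
    exact isOpen_iUnion fun v => isOpen_lt continuous_const (continuous_apply v)
  refine h1.inter (isOpen_iff_mem_nhds.2 fun x hx => ?_)
  have h2 : ∀ᶠ y in 𝓝 x, ∀ v, x v < 0 → y v < 0 :=
    Filter.eventually_all.2 fun v => by
      by_cases hv : x v < 0
      · filter_upwards [(continuous_apply v).continuousAt.eventually_lt continuousAt_const hv]
          with y hy _ using hy
      · exact Filter.Eventually.of_forall fun y h => absurd h hv
  filter_upwards [h2] with y hy
  refine hK (fun v (hv : 0 ≤ y v) => ?_) hx
  by_contra h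
  exact (hy v (not_le.1 h)).not_ge hv

theorem biInter_openRealization {α : Type*} {T : Finset α} (hT : T.Nonempty) (K : α → Set (Set V)) :
    ⋂ a ∈ T, openRealization (K a) = openRealization (⋂ a ∈ T, K a) := by
  obtain ⟨a, ha⟩ := hT
  ext x
  simp only [mem_iInter]
  constructor
  · intro h
    exact ⟨(h a ha).1, mem_iInter₂.2 fun b hb => (h b hb).2⟩
  · rintro ⟨h1, h2⟩ b hb
    exact ⟨h1, mem_iInter₂.1 h2 b hb⟩

/-- Cones can be filled in all dimensions. -/
theorem conn_openRealization_of_cone [Finite V] {K : Set (Set V)} (hK : IsLowerSet K) {v : V}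
    (hv : {v} ∈ K) (hcone : ∀ S ∈ K, insert v S ∈ K) (n : ℕ) : Conn n (openRealization K) := by
  classical
  intro ι _ _ f hf hfK
  have hf' : ∀ u, ContinuousOn (fun x => f x u) (sphere 0 1) := continuousOn_pi.1 hf
  -- During the first half of the time only the apex coordinate moves, up to 1; then the others go
  -- down to -1. In this order some coordinate is always positive.
  let H : ℝ × (ι → ℝ) → V → ℝ := fun p u =>
    if u = v then (1 - min (2 * p.1) 1) * f p.2 u + min (2 * p.1) 1
    else (1 - max (2 * p.1 - 1) 0) * f p.2 u - max (2 * p.1 - 1) 0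
  refine exists_fill_of_homotopy (H := H) (g₁ := fun _ u => if u = v then 1 else -1)
    ?_ ?_ ?_ continuousOn_const ?_ ?_
  · refine continuousOn_pi.2 fun u => ?_
    have h1 : ContinuousOn (fun p : ℝ × (ι → ℝ) => f p.2 u) (Icc 0 1 ×ˢ sphere 0 1) :=
      (hf' u).comp continuousOn_snd fun p hp => hp.2
    by_cases hu : u = v
    · simp only [H, if_pos hu]
      exact (ContinuousOn.mul (by fun_prop) h1).add (by fun_prop)
    · simp only [H, if_neg hu]
      exact (ContinuousOn.mul (by fun_prop) h1).sub (by fun_prop)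
  · rintro ⟨t, x⟩ ⟨⟨ht0, ht1⟩, hx⟩
    dsimp only at ht0 ht1 hx
    obtain ⟨⟨w, hw⟩, hS⟩ := hfK hx
    constructor
    · by_cases h : 1 ≤ 2 * t
      · exact ⟨v, by simp [H, min_eq_right h]⟩
      · rw [not_le] at h
        refine ⟨w, ?_⟩
        by_cases hwv : w = v
        · simp only [H, if_pos hwv, min_eq_left h.le]
          nlinarith
        · simp only [H, if_neg hwv, max_eq_right (show 2 * t - 1 ≤ 0 by linarith)]
          linarith
    · refine hK (fun u (hu : 0 ≤ H (t, x) u) => ?_) (hcone _ hS)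
      by_cases huv : u = v
      · exact Or.inl huv
      · refine Or.inr (show 0 ≤ f x u from ?_)
        simp only [H, if_neg huv] at hu
        by_contra! hneg
        have h1 : 0 ≤ max (2 * t - 1) 0 := le_max_right _ _
        have h2 : max (2 * t - 1) 0 ≤ 1 := max_le (by linarith) zero_le_one
        have h3 := mul_nonpos_of_nonneg_of_nonpos (sub_nonneg.2 h2) hneg.le
        have h4 : max (2 * t - 1) 0 = 0 := le_antisymm (by linarith) h1
        rw [h4] at hu
        linarith
  · intro x _
    funext u
    simp [H]
  · intro x _
    refine ⟨⟨v, by simp⟩, hK (fun u (hu : 0 ≤ if u = v then (1 : ℝ) else -1) => ?_) hv⟩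
    by_contra h
    rw [mem_singleton_iff] at h
    rw [if_neg h] at hu
    linarith
  · intro x _
    funext u
    by_cases hu : u = v <;> norm_num [H, hu]

/-- The shared positive coordinate stays positive, and a coordinate negative at both ends is
negative in between. -/
theorem segment_subset_openRealization {K : Set (Set V)} (hK : IsLowerSet K) {x y : V → ℝ} {v : V}
    (hx : 0 < x v) (hy : 0 < y v) (hxy : {u | 0 ≤ x u} ∪ {u | 0 ≤ y u} ∈ K) :
    segment ℝ x y ⊆ openRealization K := by
  rintro _ ⟨a, b, ha, hb, hab, rfl⟩
  refine ⟨⟨v, ?_⟩, hK (fun u (hu : 0 ≤ a * x u + b * y u) => ?_) hxy⟩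
  · change 0 < a * x v + b * y v
    rcases ha.eq_or_lt with rfl | ha
    · rw [zero_add] at hab
      rw [hab]
      linarith
    · exact add_pos_of_pos_of_nonneg (mul_pos ha hx) (mul_nonneg hb hy.le)
  · by_contra h
    simp only [mem_union, not_or] at h
    have h1 : x u < 0 := not_le.1 h.1
    have h2 : y u < 0 := not_le.1 h.2
    have h3 := mul_nonpos_of_nonneg_of_nonpos ha h1.le
    have h4 := mul_nonpos_of_nonneg_of_nonpos hb h2.le
    rcases ha.eq_or_lt with rfl | ha
    · rw [zero_add] at hab
      rw [hab] at hu
      linarith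
    · linarith [mul_neg_of_pos_of_neg ha h1]

open Classical in
/-- An interior point of the simplex `S`, as a point of the open model. -/
noncomputable def simplexPoint (S : Set V) : V → ℝ := fun u => if u ∈ S then 1 else -1

theorem simplexPoint_nonneg_iff {S : Set V} {u : V} : 0 ≤ simplexPoint S u ↔ u ∈ S := by
  by_cases h : u ∈ S <;> simp [simplexPoint, h]

theorem simplexPoint_pos {S : Set V} {u : V} (h : u ∈ S) : 0 < simplexPoint S u := by
  simp [simplexPoint, h]

theorem setOf_simplexPoint_nonneg (S : Set V) : {u | 0 ≤ simplexPoint S u} = S :=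
  Set.ext fun _ => simplexPoint_nonneg_iff

theorem simplexPoint_mem {K : Set (Set V)} {S : Set V} (hS : S ∈ K) (hne : S.Nonempty) :
    simplexPoint S ∈ openRealization K :=
  ⟨hne.imp fun _ h => simplexPoint_pos h, by rwa [setOf_simplexPoint_nonneg]⟩

theorem joinedIn_simplexPoint {K : Set (Set V)} (hK : IsLowerSet K) {x : V → ℝ} {S S' : Set V}
    {v : V} (hx : 0 < x v) (hxS : {u | 0 ≤ x u} ⊆ S') (hv : v ∈ S) (hSS' : S ⊆ S')
    (hS' : S' ∈ K) : JoinedIn (openRealization K) x (simplexPoint S) :=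
  JoinedIn.of_segment_subset (segment_subset_openRealization hK hx (simplexPoint_pos hv)
    (hK (union_subset hxS (by rwa [setOf_simplexPoint_nonneg])) hS'))

theorem conn_one {X : Type*} [TopologicalSpace X] {Y : Set X} (h : Y.Nonempty) : Conn 1 Y := by
  intro ι _ hι
  have : IsEmpty ι := Fintype.card_eq_zero_iff.1 (by omega)
  exact fill_of_isEmpty h

/-- The unit sphere of a line is a pair of points, and a path between their images is a filling. -/
theorem conn_two {X : Type*} [TopologicalSpace X] {Y : Set X} (h : IsPathConnected Y) :
    Conn 2 Y := by
  intro ι _ hι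
  rcases (show Fintype.card ι = 0 ∨ Fintype.card ι = 1 by omega) with h0 | h1
  · have : IsEmpty ι := Fintype.card_eq_zero_iff.1 h0
    exact fill_of_isEmpty h.nonempty
  · obtain ⟨i, hi⟩ := Fintype.card_eq_one_iff.1 h1
    intro f hf hfY
    have hs : ∀ z : ι → ℝ, z ∈ sphere (0 : ι → ℝ) 1 ↔ z i = 1 ∨ z i = -1 := by
      intro z
      rw [mem_unit_sphere_pi]
      constructor
      · rintro ⟨-, j, hj⟩
        rw [hi j] at hj
        exact eq_or_eq_neg_of_abs_eq hj
      · intro h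
        have : |z i| = 1 := by rcases h with h | h <;> simp [h]
        exact ⟨fun j => by rw [hi j, this], i, this⟩
    have hJ := h.joinedIn (f fun _ => -1) (hfY ((hs _).2 (Or.inr rfl))) (f fun _ => 1)
      (hfY ((hs _).2 (Or.inl rfl)))
    refine ⟨fun z => hJ.somePath.extend ((z i + 1) / 2), ?_, ?_, ?_⟩
    · exact (hJ.somePath.continuous_extend.comp (by fun_prop)).continuousOn
    · intro z hz
      obtain ⟨t, ht⟩ : hJ.somePath.extend ((z i + 1) / 2) ∈ range hJ.somePath := by
        rw [← Path.extend_range]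
        exact mem_range_self _
      dsimp only
      rw [← ht]
      exact hJ.somePath_mem t
    · intro z hz
      have hz' : z = fun _ => z i := funext fun j => by rw [hi j]
      rcases (hs z).1 hz with h | h
      · rw [h] at hz'
        subst hz'
        norm_num
      · rw [h] at hz'
        subst hz'
        norm_num

end OpenRealization

/-! ### Flag complexes covered by stars -/

section Flag
variable {V : Type*} (R : V → V → Prop)

/-- The simplices (including the empty one) of the flag complex of `R` with vertices in `W`. -/
def flagFaces (W : Set V) : Set (Set V) := {S | S ⊆ W ∧ S.Pairwise R}

/-- The star of `v` in the flag complex. -/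
def flagStar (W : Set V) (v : V) : Set (Set V) := {S | insert v S ∈ flagFaces R W}

variable {R}

theorem isLowerSet_flagFaces (W : Set V) : IsLowerSet (flagFaces R W) :=
  fun _ _ h hS => ⟨h.trans hS.1, hS.2.mono h⟩

theorem isLowerSet_flagStar (W : Set V) (v : V) : IsLowerSet (flagStar R W v) :=
  fun _ _ h hS => isLowerSet_flagFaces W (insert_subset_insert h) hS

theorem isLowerSet_biInter_flagStar (W : Set V) (T : Finset V) :
    IsLowerSet (⋂ v ∈ T, flagStar R W v) :=
  isLowerSet_iInter₂ fun v _ => isLowerSet_flagStar W v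

theorem openRealization_flagFaces (W : Finset V) :
    openRealization (flagFaces R (W : Set V)) = ⋃ v ∈ W, openRealization (flagStar R (W : Set V) v) := by
  ext x
  simp only [mem_iUnion]
  constructor
  · rintro ⟨⟨v, hv⟩, hx⟩
    refine ⟨v, hx.1 hv.le, ⟨v, hv⟩, ?_⟩
    rwa [flagStar, mem_ofPred_eq, insert_eq_of_mem (show v ∈ {v | 0 ≤ x v} from hv.le)]
  · rintro ⟨v, hv, h1, h2⟩
    exact ⟨h1, isLowerSet_flagFaces _ (subset_insert _ _) h2⟩

/-- A simplex in all the stars cannot contain a member of `T`, as that member would be related to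
all other members. All its vertices are then related to all of `T`. -/
theorem biInter_flagStar_of_not_cone (hsymm : Std.Symm R) {W : Set V}
    {T : Finset V} (hTW : (T : Set V) ⊆ W) (hT0 : T.Nonempty)
    (hT : ∀ v ∈ T, ∃ w ∈ T, w ≠ v ∧ ¬R v w) :
    ⋂ v ∈ T, flagStar R W v = flagFaces R {u ∈ W | ∀ w ∈ T, R u w} := by
  ext S
  rw [mem_iInter₂]
  constructor
  · intro h
    obtain ⟨v, hv⟩ := hT0
    have hS := isLowerSet_flagFaces W (subset_insert _ _) (h v hv)
    refine ⟨fun u hu => ⟨hS.1 hu, fun w hw => ?_⟩, hS.2⟩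
    by_cases huw : u = w
    · subst huw
      obtain ⟨w, hw', hne, hn⟩ := hT u hw
      exact absurd ((h w hw').2 (mem_insert_of_mem _ hu) (mem_insert _ _) hne.symm) hn
    · exact (h w hw).2 (mem_insert_of_mem _ hu) (mem_insert _ _) huw
  · rintro ⟨h1, h2⟩ v hv
    refine ⟨insert_subset (hTW hv) fun u hu => (h1 hu).1, ?_⟩
    exact h2.insert fun u hu _ => ⟨hsymm.symm _ _ ((h1 hu).2 v hv), (h1 hu).2 v hv⟩

/-- The intersection is a cone with apex `v`: by flagness, adding `v` to a simplex keeps it in the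
star of every `w` in `T`. -/
theorem conn_biInter_flagStar_of_cone [Finite V] (hsymm : Std.Symm R) {W : Set V} {T : Finset V}
    (hTW : (T : Set V) ⊆ W) {v : V} (hv : v ∈ T) (hT : ∀ w ∈ T, w ≠ v → R v w) (n : ℕ) :
    Conn n (openRealization (⋂ w ∈ T, flagStar R W w)) := by
  have hcone : ∀ S ∈ ⋂ w ∈ T, flagStar R W w, insert v S ∈ ⋂ w ∈ T, flagStar R W w := by
    intro S hS
    rw [mem_iInter₂] at *
    intro w hw
    refine ⟨insert_subset (hTW hw) (hS v hv).1, (hS v hv).2.insert fun u hu hne => ?_⟩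
    rcases hu with rfl | hu
    · exact ⟨hsymm.symm _ _ (hT w hw hne), hT w hw hne⟩
    · have := (hS w hw).2
      exact ⟨this (mem_insert _ _) (mem_insert_of_mem _ hu) hne,
        this (mem_insert_of_mem _ hu) (mem_insert _ _) hne.symm⟩
  refine conn_openRealization_of_cone (isLowerSet_biInter_flagStar W T) (v := v) ?_ hcone n
  have := hcone ∅ (mem_iInter₂.2 fun w hw => ⟨by simpa using hTW hw, by simp⟩)
  rwa [insert_empty_eq] at this

/-- Connectivity of a flag complex from the connectivity of common links. -/
theorem conn_flagFaces [Finite V] (hsymm : Std.Symm R) {n : ℕ}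
    {W : Finset V} (hW : W.Nonempty)
    (h : ∀ T ⊆ W, 2 ≤ T.card →
      Conn (n + 1 - T.card) (openRealization (flagFaces R {u ∈ (W : Set V) | ∀ w ∈ T, R u w}))) :
    Conn n (openRealization (flagFaces R (W : Set V))) := by
  classical
  rw [openRealization_flagFaces]
  refine Conn.biUnion (fun v => isOpen_openRealization (isLowerSet_flagStar _ v)) hW
    fun T hTW hT0 => ?_
  rw [biInter_openRealization hT0]
  by_cases hT : ∃ v ∈ T, ∀ w ∈ T, w ≠ v → R v w
  · obtain ⟨v, hv, hT⟩ := hT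
    exact conn_biInter_flagStar_of_cone hsymm (Finset.coe_subset.2 hTW) hv hT _
  · push Not at hT
    rw [biInter_flagStar_of_not_cone hsymm (Finset.coe_subset.2 hTW) hT0 hT]
    refine h T hTW ?_
    obtain ⟨v, hv⟩ := hT0
    obtain ⟨w, hw, hne, -⟩ := hT v hv
    exact Finset.one_lt_card.2 ⟨w, hw, v, hv, hne⟩

theorem joinedIn_vertices {W : Set V} (hsymm : Std.Symm R) {v w : V} (hv : v ∈ W) (hw : w ∈ W)
    (h : R v w) :
    JoinedIn (openRealization (flagFaces R W)) (simplexPoint {v}) (simplexPoint {w}) := by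
  have hS : ({v, w} : Set V) ∈ flagFaces R W :=
    ⟨by simp [insert_subset_iff, hv, hw],
      (pairwise_singleton _ _).insert fun u hu _ => by
        rw [mem_singleton_iff.1 hu]
        exact ⟨h, hsymm.symm _ _ h⟩⟩
  refine (joinedIn_simplexPoint (isLowerSet_flagFaces W) (simplexPoint_pos (mem_singleton v))
    (S := {v, w}) ?_ (by simp) subset_rfl hS).trans
    (joinedIn_simplexPoint (isLowerSet_flagFaces W) (simplexPoint_pos (mem_singleton w))
    (S := {v, w}) ?_ (by simp) subset_rfl hS).symm
  · rw [setOf_simplexPoint_nonneg]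
    simp
  · rw [setOf_simplexPoint_nonneg]
    simp

/-- The flag complex of a connected graph is path connected. -/
theorem isPathConnected_flagFaces (hsymm : Std.Symm R) {W : Set V} {v₀ : V} (hv₀ : v₀ ∈ W)
    (h : ∀ v ∈ W, Relation.ReflTransGen (fun a b => b ∈ W ∧ R a b) v₀ v) :
    IsPathConnected (openRealization (flagFaces R W)) := by
  have hp : ∀ v ∈ W, simplexPoint {v} ∈ openRealization (flagFaces R W) := fun v hv =>
    simplexPoint_mem ⟨by simpa using hv, pairwise_singleton _ _⟩ (singleton_nonempty v)
  refine ⟨simplexPoint {v₀}, hp v₀ hv₀, fun {x} hx => ?_⟩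
  obtain ⟨⟨v, hv⟩, hS⟩ := hx
  refine JoinedIn.trans ?_ (joinedIn_simplexPoint (isLowerSet_flagFaces W) hv subset_rfl
    (mem_singleton v) (by simpa using hv.le) hS).symm
  have key : ∀ w, Relation.ReflTransGen (fun a b => b ∈ W ∧ R a b) v₀ w → w ∈ W ∧
      JoinedIn (openRealization (flagFaces R W)) (simplexPoint {v₀}) (simplexPoint {w}) := by
    intro w hw
    induction hw with
    | refl => exact ⟨hv₀, JoinedIn.refl (hp v₀ hv₀)⟩
    | tail _ hbc ih => exact ⟨hbc.1, ih.2.trans (joinedIn_vertices hsymm ih.1 hbc.1 hbc.2)⟩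
  exact (key v (h v (hS.1 hv.le))).2

end Flag

/-! ### The descending link as a flag complex -/

section DescendingLink
variable {k ℓ : ℕ}

/-- Two vertices of the descending link are compatible if their contacts are distinct. -/
def Compat (t u : DescendingVertex k ℓ) : Prop :=
  (t.left ≠ u.left ∧ t.left ≠ u.right ∧ t.right ≠ u.left ∧ t.right ≠ u.right) ∧
    t.color ≠ u.color

theorem compat_symm : Std.Symm (Compat (k := k) (ℓ := ℓ)) :=
  ⟨fun _ _ h => ⟨⟨h.1.1.symm, h.1.2.2.1.symm, h.1.2.1.symm, h.1.2.2.2.symm⟩, h.2.symm⟩⟩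

theorem left_ne_right (t : DescendingVertex k ℓ) : t.left ≠ t.right := t.2

/-- The vertices with `x`-contacts in `P` and `a`-contact in `C`. -/
def vertsIn (P : Finset (Fin k)) (C : Finset (Fin ℓ)) : Finset (DescendingVertex k ℓ) :=
  Finset.univ.filter fun t => (t.left ∈ P ∧ t.right ∈ P) ∧ t.color ∈ C

theorem mem_vertsIn {P : Finset (Fin k)} {C : Finset (Fin ℓ)} {t : DescendingVertex k ℓ} :
    t ∈ vertsIn P C ↔ (t.left ∈ P ∧ t.right ∈ P) ∧ t.color ∈ C := by
  simp [vertsIn]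

theorem exists_mem_vertsIn {P : Finset (Fin k)} {C : Finset (Fin ℓ)} {Q : Finset (Fin k)}
    {c : Fin ℓ} (hP : Q.card + 2 ≤ P.card) (hc : c ∈ C) :
    ∃ t ∈ vertsIn P C, t.left ∉ Q ∧ t.right ∉ Q ∧ t.color = c := by
  obtain ⟨a, ha, b, hb, hab⟩ := Finset.one_lt_card.1
    (show 1 < (P \ Q).card by have := Finset.le_card_sdiff Q P; omega)
  rw [Finset.mem_sdiff] at ha hb
  exact ⟨⟨(a, b, c), hab⟩, mem_vertsIn.2 ⟨⟨ha.1, hb.1⟩, hc⟩, ha.2, hb.2, rfl⟩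

theorem vertsIn_nonempty {P : Finset (Fin k)} {C : Finset (Fin ℓ)} (hP : 2 ≤ P.card)
    (hC : 1 ≤ C.card) : (vertsIn P C).Nonempty := by
  obtain ⟨c, hc⟩ := Finset.card_pos.1 hC
  obtain ⟨t, ht, -⟩ := exists_mem_vertsIn (Q := ∅) (by simpa using hP) hc
  exact ⟨t, ht⟩

theorem openRealization_vertsIn_nonempty {P : Finset (Fin k)} {C : Finset (Fin ℓ)}
    (hP : 2 ≤ P.card) (hC : 1 ≤ C.card) :
    (openRealization
      (flagFaces Compat (vertsIn P C : Set (DescendingVertex k ℓ)))).Nonempty := by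
  obtain ⟨u, hu⟩ := vertsIn_nonempty hP hC
  exact ⟨simplexPoint {u}, simplexPoint_mem
    ⟨singleton_subset_iff.2 (Finset.mem_coe.2 hu), pairwise_singleton _ _⟩ (singleton_nonempty u)⟩

/-- Vertices with disjoint `x`-contacts are joined by a path if there are three colours. -/
theorem reachable_of_disjoint {P : Finset (Fin k)} {C : Finset (Fin ℓ)} (hC : 3 ≤ C.card)
    {v w : DescendingVertex k ℓ} (hv : v ∈ vertsIn P C) (hw : w ∈ vertsIn P C)
    (h : v.left ≠ w.left ∧ v.left ≠ w.right ∧ v.right ≠ w.left ∧ v.right ≠ w.right) :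
    Relation.ReflTransGen (fun a b => b ∈ (vertsIn P C : Set _) ∧ Compat a b) v w := by
  by_cases hc : v.color = w.color
  · obtain ⟨c₁, hc₁⟩ := Finset.card_pos.1
      (show 0 < (C \ {v.color}).card by
        have := Finset.le_card_sdiff {v.color} C
        rw [Finset.card_singleton] at this
        omega)
    obtain ⟨c₂, hc₂⟩ := Finset.card_pos.1
      (show 0 < (C \ {v.color, c₁}).card by
        have := Finset.le_card_sdiff {v.color, c₁} C
        have := Finset.card_le_two (a := v.color) (b := c₁)
        omega)
    simp only [Finset.mem_sdiff, Finset.mem_singleton, Finset.mem_insert, not_or] at hc₁ hc₂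
    rw [mem_vertsIn] at hv hw
    -- The path alternates between the two pairs of positions, `v, w', v', w`, with colours changing
    -- at each step.
    let w' : DescendingVertex k ℓ := ⟨(w.left, w.right, c₁), left_ne_right w⟩
    let v' : DescendingVertex k ℓ := ⟨(v.left, v.right, c₂), left_ne_right v⟩
    have h1 : w' ∈ vertsIn P C ∧ Compat v w' :=
      ⟨mem_vertsIn.2 ⟨hw.1, hc₁.1⟩, h, Ne.symm hc₁.2⟩
    have h2 : v' ∈ vertsIn P C ∧ Compat w' v' :=
      ⟨mem_vertsIn.2 ⟨hv.1, hc₂.1⟩, compat_symm.symm _ _ ⟨h, hc₂.2.2⟩⟩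
    have h3 : w ∈ vertsIn P C ∧ Compat v' w :=
      ⟨mem_vertsIn.2 hw, h, fun h => hc₂.2.1 (h.trans hc.symm)⟩
    exact .tail (.tail (.single h1) h2) h3
  · exact .single ⟨hw, h, hc⟩

/-- Two vertices sharing a position occupy at most three; five positions leave room for a third
vertex disjoint from both. -/
theorem reachable {P : Finset (Fin k)} {C : Finset (Fin ℓ)} (hP : 5 ≤ P.card) (hC : 3 ≤ C.card)
    {v w : DescendingVertex k ℓ} (hv : v ∈ vertsIn P C) (hw : w ∈ vertsIn P C) :
    Relation.ReflTransGen (fun a b => b ∈ (vertsIn P C : Set _) ∧ Compat a b) v w := by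
  by_cases h : v.left ≠ w.left ∧ v.left ≠ w.right ∧ v.right ≠ w.left ∧ v.right ≠ w.right
  · exact reachable_of_disjoint hC hv hw h
  · have hQ : ∃ Q : Finset (Fin k), Q.card ≤ 3 ∧
        v.left ∈ Q ∧ v.right ∈ Q ∧ w.left ∈ Q ∧ w.right ∈ Q := by
      by_cases h1 : v.left = w.left ∨ v.right = w.left
      · refine ⟨{v.left, v.right, w.right}, Finset.card_le_three, ?_⟩
        rcases h1 with h1 | h1 <;> simp [← h1]
      · refine ⟨{v.left, v.right, w.left}, Finset.card_le_three, ?_⟩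
        have h2 : v.left = w.right ∨ v.right = w.right := by tauto
        rcases h2 with h2 | h2 <;> simp [← h2]
    obtain ⟨Q, hQ, q1, q2, q3, q4⟩ := hQ
    obtain ⟨u, hu, hl, hr, -⟩ := exists_mem_vertsIn (C := C) (Q := Q)
      (show Q.card + 2 ≤ P.card by omega) (mem_vertsIn.1 hv).2
    have key : ∀ {a : Fin k}, a ∈ Q → a ≠ u.left ∧ a ≠ u.right := fun ha =>
      ⟨fun h => hl (h ▸ ha), fun h => hr (h ▸ ha)⟩
    exact (reachable_of_disjoint hC hv hu
      ⟨(key q1).1, (key q1).2, (key q2).1, (key q2).2⟩).trans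
      (reachable_of_disjoint hC hu hw
      ⟨(key q3).1.symm, (key q4).1.symm, (key q3).2.symm, (key q4).2.symm⟩)

/-- Common links are descending links on the remaining contacts. -/
theorem setOf_compat_eq (P : Finset (Fin k)) (C : Finset (Fin ℓ))
    (T : Finset (DescendingVertex k ℓ)) :
    {u ∈ (vertsIn P C : Set (DescendingVertex k ℓ)) | ∀ w ∈ T, Compat u w} =
      (vertsIn (P \ (T.image DescendingVertex.left ∪ T.image DescendingVertex.right))
        (C \ T.image DescendingVertex.color) : Set (DescendingVertex k ℓ)) := by
  ext u
  simp only [Finset.mem_coe, mem_vertsIn, Finset.mem_sdiff, Finset.mem_union, Finset.mem_image,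
    not_or, not_exists, not_and, Compat, mem_ofPred_eq]
  constructor
  · rintro ⟨⟨⟨h1, h2⟩, h3⟩, h⟩
    exact ⟨⟨⟨h1, fun w hw => (h w hw).1.1.symm, fun w hw => (h w hw).1.2.1.symm⟩,
      h2, fun w hw => (h w hw).1.2.2.1.symm, fun w hw => (h w hw).1.2.2.2.symm⟩,
      h3, fun w hw => (h w hw).2.symm⟩
  · rintro ⟨⟨⟨h1, h4, h5⟩, h2, h6, h7⟩, h3, h8⟩
    exact ⟨⟨⟨h1, h2⟩, h3⟩, fun w hw => ⟨⟨Ne.symm (h4 w hw), Ne.symm (h5 w hw),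
      Ne.symm (h6 w hw), Ne.symm (h7 w hw)⟩, Ne.symm (h8 w hw)⟩⟩

/-- The constants 5 and 3 come from path-connectedness. The slopes 4 and 2 are what `|T| = 2` costs:
up to four positions and two colours for one degree. Larger `T` leave slack, since each further
vertex lowers the required degree by one. -/
theorem conn_vertsIn (n : ℕ) (P : Finset (Fin k)) (C : Finset (Fin ℓ)) (hP : 4 * n + 5 ≤ P.card)
    (hC : 2 * n + 3 ≤ C.card) :
    Conn (n + 2) (openRealization
      (flagFaces Compat (vertsIn P C : Set (DescendingVertex k ℓ)))) := by
  induction n using Nat.strong_induction_on generalizing P C with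
  | _ n ih =>
  obtain ⟨v₀, hv₀⟩ := vertsIn_nonempty (show 2 ≤ P.card by omega) (show 1 ≤ C.card by omega)
  rcases n with _ | n
  · exact conn_two (isPathConnected_flagFaces compat_symm hv₀ fun v hv =>
      reachable (by omega) (by omega) hv₀ hv)
  refine conn_flagFaces compat_symm ⟨v₀, hv₀⟩ fun T _ hT2 => ?_
  rw [setOf_compat_eq]
  have hP' := Finset.le_card_sdiff
    (T.image DescendingVertex.left ∪ T.image DescendingVertex.right) P
  have hC' := Finset.le_card_sdiff (T.image DescendingVertex.color) C
  have h1 := Finset.card_union_le (T.image DescendingVertex.left) (T.image DescendingVertex.right)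
  have h2 := Finset.card_image_le (s := T) (f := DescendingVertex.left)
  have h3 := Finset.card_image_le (s := T) (f := DescendingVertex.right)
  have h4 := Finset.card_image_le (s := T) (f := DescendingVertex.color)
  -- The required `Conn` index is `n + 4 - T.card`: at least 2, where induction applies; 1, which is
  -- nonemptiness; or 0, which is vacuous.
  rcases (show T.card ≤ n + 2 ∨ T.card = n + 3 ∨ n + 4 ≤ T.card by omega) with h | h | h
  · exact (ih (n + 2 - T.card) (by omega) _ _ (by omega) (by omega)).mono (by omega)
  · exact (conn_one (openRealization_vertsIn_nonempty (le_trans (by omega) hP')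
      (le_trans (by omega) hC'))).mono (by omega)
  · exact (conn_zero _).mono (by omega)

theorem mem_descendingLinkQV_faces {S : Finset (DescendingVertex k ℓ)} :
    S ∈ (descendingLinkQV k ℓ).faces ↔
      S.Nonempty ∧ (S : Set (DescendingVertex k ℓ)).Pairwise Compat := by
  refine and_congr_right fun _ => ?_
  rw [Multiset.nodup_bind, Multiset.nodup_map_iff_inj_on S.nodup]
  have : Std.Symm (Function.onFun Disjoint fun t : DescendingVertex k ℓ =>
      ({t.left, t.right} : Multiset (Fin k))) := ⟨fun _ _ h => h.symm⟩
  have hdisj : ∀ t u : DescendingVertex k ℓ,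
      Disjoint ({t.left, t.right} : Multiset (Fin k)) {u.left, u.right} ↔
        t.left ≠ u.left ∧ t.left ≠ u.right ∧ t.right ≠ u.left ∧ t.right ≠ u.right := by
    intro t u
    simp [Multiset.disjoint_left, and_assoc]
  constructor
  · rintro ⟨⟨-, h⟩, hc⟩ t ht u hu hne
    exact ⟨(hdisj t u).1 (h.forall ht hu hne), fun h => hne (hc t ht u hu h)⟩
  · refine fun h => ⟨⟨fun t _ => by simpa using left_ne_right t, ?_⟩, fun t ht u hu htu => ?_⟩
    · exact Multiset.Nodup.pairwise (fun t ht u hu hne => (hdisj t u).2 (h ht hu hne).1) S.nodup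
    · by_contra hne
      exact (h ht hu hne).2 htu

end DescendingLink

/-! ### From the open model to barycentric coordinates -/

section Realization
variable {V : Type*} [Fintype V]

/-- Radial projection of the positive part onto the standard simplex. -/
noncomputable def simplexProj (y : V → ℝ) : V → ℝ := fun v => max (y v) 0 / ∑ w, max (y w) 0

theorem sum_max_pos {y : V → ℝ} (hy : ∃ v, 0 < y v) : 0 < ∑ w, max (y w) 0 := by
  obtain ⟨v, hv⟩ := hy
  exact Finset.sum_pos' (fun w _ => le_max_right _ _) ⟨v, Finset.mem_univ v, lt_max_of_lt_left hv⟩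

theorem continuousOn_simplexProj :
    ContinuousOn (simplexProj (V := V)) {y | ∃ v, 0 < y v} :=
  continuousOn_pi.2 fun _ => ContinuousOn.div (by fun_prop) (by fun_prop)
    fun _ hy => (sum_max_pos hy).ne'

theorem simplexProj_mem {A : AbstractSimplicialComplex V} {y : V → ℝ} (hy : ∃ v, 0 < y v)
    {s : Finset V} (hs : s ∈ A.faces) (hys : ∀ v, 0 < y v → v ∈ s) :
    simplexProj y ∈ A.realization := by
  have h := sum_max_pos hy
  refine ⟨⟨fun v => div_nonneg (le_max_right _ _) h.le, ?_⟩, s, hs, fun v hv => ?_⟩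
  · simp only [simplexProj]
    rw [← Finset.sum_div, div_self h.ne']
  · refine hys v (not_le.1 fun hv' => hv ?_)
    simp [simplexProj, max_eq_right hv']

theorem simplexProj_of_mem_stdSimplex {y : V → ℝ} (hy : y ∈ stdSimplex ℝ V) :
    simplexProj y = y := by
  funext v
  simp only [simplexProj]
  rw [Finset.sum_congr rfl fun w _ => max_eq_left (hy.1 w), hy.2, div_one, max_eq_left (hy.1 v)]

/-- The open model of a complex can replace its geometric realization. -/
theorem Fill.realization {A : AbstractSimplicialComplex V} {K : Set (Set V)}
    (hK : ∀ S : Set V, S.Nonempty → (S ∈ K ↔ ∃ s ∈ A.faces, S ⊆ s)) {ι : Type} [Fintype ι]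
    (h : Fill ι (openRealization K)) : Fill ι A.realization := by
  intro f hf hfA
  -- Barycentric coordinates sum to 1, so one of them exceeds this `ε`. Subtracting `ε` makes zero
  -- coordinates negative and lands in the open model; raising the threshold from 0 to `ε` and
  -- projecting gives the homotopy below.
  let ε : ℝ := 1 / (Fintype.card V + 1)
  have hε : 0 < ε := by positivity
  have hbig : ∀ x ∈ sphere (0 : ι → ℝ) 1, ∃ v, ε < f x v := by
    intro x hx
    by_contra! hle
    have h1 := Finset.sum_le_sum fun v (_ : v ∈ Finset.univ) => hle v
    rw [(hfA hx).1.2, Finset.sum_const, nsmul_eq_mul, Finset.card_univ] at h1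
    have h2 : (Fintype.card V : ℝ) * ε < 1 := by
      simp only [ε]
      rw [mul_one_div, div_lt_one (by positivity)]
      linarith
    linarith
  obtain ⟨g, hg, hgK, hgf⟩ := h (fun x v => f x v - ε)
    (continuousOn_pi.2 fun v => (continuousOn_pi.1 hf v).sub continuousOn_const) (by
      intro x hx
      obtain ⟨v, hv⟩ := hbig x hx
      obtain ⟨-, s, hs, hsup⟩ := hfA hx
      refine ⟨⟨v, sub_pos.2 hv⟩, (hK _ ⟨v, (sub_pos.2 hv).le⟩).2 ⟨s, hs, fun u hu => ?_⟩⟩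
      exact hsup u (hε.trans_le (sub_nonneg.1 hu)).ne')
  have hpos : ∀ p ∈ Icc (0 : ℝ) 1 ×ˢ sphere (0 : ι → ℝ) 1, ∃ v, 0 < f p.2 v - p.1 * ε := by
    rintro ⟨t, x⟩ ⟨⟨_, ht⟩, hx⟩
    obtain ⟨v, hv⟩ := hbig x hx
    exact ⟨v, by dsimp only at *; nlinarith⟩
  refine exists_fill_of_homotopy (H := fun p => simplexProj fun v => f p.2 v - p.1 * ε)
    (g₁ := fun x => simplexProj (g x)) ?_ ?_ ?_ ?_ ?_ ?_
  · refine continuousOn_simplexProj.comp (continuousOn_pi.2 fun v => ?_) hpos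
    exact ((continuousOn_pi.1 hf v).comp continuousOn_snd fun p hp => hp.2).sub (by fun_prop)
  · rintro ⟨t, x⟩ hp
    obtain ⟨-, s, hs, hsup⟩ := hfA hp.2
    refine simplexProj_mem (hpos _ hp) hs fun v hv => hsup v ?_
    have := mul_nonneg hp.1.1 hε.le
    dsimp only at *
    exact ne_of_gt (by linarith)
  · intro x hx
    simp [simplexProj_of_mem_stdSimplex (hfA hx).1]
  · exact continuousOn_simplexProj.comp hg fun x hx => (hgK hx).1
  · intro x hx
    obtain ⟨⟨v, hv⟩, hS⟩ := hgK hx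
    obtain ⟨s, hs, hsub⟩ := (hK _ ⟨v, hv.le⟩).1 hS
    exact simplexProj_mem ⟨v, hv⟩ hs fun u hu => hsub hu.le
  · intro x hx
    simp [hgf hx]

end Realization

/-! ### Homotopy groups -/

section HomotopyGroups
variable {X : Type*} [TopologicalSpace X] {Y : Set X}

/-- Filling spheres kills homotopy groups. -/
theorem subsingleton_homotopyGroup {i : ℕ} (h : Fill (Fin (i + 1)) Y) (x : Y) :
    Subsingleton (HomotopyGroup.Pi i Y x) := by
  refine ⟨fun a b => Quotient.inductionOn₂ a b fun p q => Quotient.sound ?_⟩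
  change p.1.HomotopicRel q.1 (Cube.boundary (Fin i))
  let P : (Fin (i + 1) → ℝ) → Fin i → unitInterval := fun y j =>
    projIcc 0 1 zero_le_one ((y j.succ + 1) / 2)
  have hP : Continuous P := continuous_pi fun j => continuous_projIcc.comp (by fun_prop)
  have hbd : ∀ y ∈ sphere (0 : Fin (i + 1) → ℝ) 1, |y 0| ≠ 1 → P y ∈ Cube.boundary (Fin i) := by
    intro y hy h0
    obtain ⟨-, j, hj⟩ := mem_unit_sphere_pi.1 hy
    obtain ⟨j, rfl⟩ := Fin.exists_succ_eq.2 fun h => h0 (h ▸ hj)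
    refine ⟨j, ?_⟩
    rcases eq_or_eq_neg_of_abs_eq hj with hj | hj <;> simp [P, hj]
  -- The sphere is the boundary of a cube with `p` on the bottom, `q` on the top and the base point
  -- on the sides. A filling, reparametrized by `E`, is a homotopy from `p` to `q` relative to the
  -- boundary.
  let f : (Fin (i + 1) → ℝ) → Y := fun y => if y 0 ≤ 0 then p (P y) else q (P y)
  have e1 : EqOn f (fun y => p (P y)) (sphere 0 1 ∩ {y | y 0 ≤ 0}) := fun y hy => if_pos hy.2
  have e2 : EqOn f (fun y => q (P y)) (sphere 0 1 ∩ {y | 0 ≤ y 0}) := by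
    rintro y ⟨hy, hy0⟩
    by_cases h0 : y 0 ≤ 0
    · have h1 : P y ∈ Cube.boundary (Fin i) :=
        hbd y hy (by rw [le_antisymm h0 hy0]; simp)
      simp only [f, if_pos h0, GenLoop.boundary p _ h1, GenLoop.boundary q _ h1]
    · exact if_neg h0
  have hf : ContinuousOn f (sphere 0 1) := by
    refine ContinuousOn.mono (ContinuousOn.union_of_isClosed
      (((p.1.continuous.comp hP).continuousOn).congr e1)
      (((q.1.continuous.comp hP).continuousOn).congr e2)
      (isClosed_sphere.inter (isClosed_le (by fun_prop) continuous_const))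
      (isClosed_sphere.inter (isClosed_le continuous_const (by fun_prop)))) ?_
    intro y hy
    exact (le_total (y 0) 0).imp (fun h => ⟨hy, h⟩) fun h => ⟨hy, h⟩
  obtain ⟨g, hg, hgY, hgf⟩ := h (fun y => (f y : X)) (continuous_subtype_val.comp_continuousOn hf)
    fun y _ => (f y).2
  let E : unitInterval × (Fin i → unitInterval) → Fin (i + 1) → ℝ := fun z =>
    Fin.cons (2 * (z.1 : ℝ) - 1) fun j => 2 * (z.2 j : ℝ) - 1
  have hE : Continuous E := by
    refine continuous_pi fun j => ?_
    refine Fin.cases ?_ (fun j => ?_) j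
    · simp only [E, Fin.cons_zero]
      fun_prop
    · simp only [E, Fin.cons_succ]
      fun_prop
  have habs : ∀ t : unitInterval, |2 * (t : ℝ) - 1| ≤ 1 := fun t => by
    rw [abs_le]
    constructor <;> linarith [t.2.1, t.2.2]
  have hEle : ∀ z j, |E z j| ≤ 1 := fun z j =>
    Fin.cases (habs z.1) (fun j => habs (z.2 j)) j
  have hEb : ∀ z, E z ∈ closedBall (0 : Fin (i + 1) → ℝ) 1 := fun z => by
    rw [mem_closedBall_zero_iff]
    exact (pi_norm_le_iff_of_nonneg zero_le_one).2 (hEle z)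
  have hPE : ∀ z, P (E z) = z.2 := by
    intro z
    funext j
    have : (E z j.succ + 1) / 2 = z.2 j := by simp [E]
    simp only [P, this, projIcc_val]
  have hEs : ∀ z j, |E z j| = 1 → g (E z) = f (E z) := fun z j hj =>
    hgf (mem_unit_sphere_pi.2 ⟨hEle z, j, hj⟩)
  refine ⟨⟨⟨⟨fun z => ⟨g (E z), hgY (hEb z)⟩, ?_⟩, ?_, ?_⟩, ?_⟩⟩
  · exact (hg.comp_continuous hE hEb).subtype_mk _
  · intro z
    refine Subtype.ext ?_
    have h0 : E (0, z) 0 = -1 := by simp [E]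
    change g (E (0, z)) = _
    rw [hEs (0, z) 0 (by simp [h0])]
    simp only [f, h0, if_pos (show (-1 : ℝ) ≤ 0 by norm_num), hPE]
    rfl
  · intro z
    refine Subtype.ext ?_
    have h0 : E (1, z) 0 = 1 := by simp [E]; norm_num
    change g (E (1, z)) = _
    rw [hEs (1, z) 0 (by simp [h0])]
    simp only [f, h0, if_neg (show ¬(1 : ℝ) ≤ 0 by norm_num), hPE]
    rfl
  · intro t z hz
    refine Subtype.ext ?_
    obtain ⟨j, hj⟩ := id hz
    change g (E (t, z)) = (p z : X)
    rw [hEs (t, z) j.succ (by rcases hj with hj | hj <;> simp [E, hj]; norm_num)]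
    simp only [f, hPE, GenLoop.boundary p z hz, GenLoop.boundary q z hz, ite_self]

theorem isNConnected_of_fill {n : ℕ} (hne : Y.Nonempty)
    (h : ∀ i ≤ n, Fill (Fin (i + 1)) Y) : IsNConnected n Y :=
  ⟨hne.to_subtype, fun i hi x => subsingleton_homotopyGroup (h i hi) x⟩

end HomotopyGroups

theorem mainTheorem6 (n k ℓ : ℕ) (hk : 4 * n + 5 ≤ k) (hl : 2 * n + 3 ≤ ℓ) :
    IsNConnected n (descendingLinkQV k ℓ).realization := by
  have hconn : Conn (n + 2) (descendingLinkQV k ℓ).realization := by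
    intro ι _ hι
    refine Fill.realization (fun S hS => ?_)
      (conn_vertsIn n (Finset.univ : Finset (Fin k)) (Finset.univ : Finset (Fin ℓ))
        (by simpa using hk) (by simpa using hl) ι hι)
    constructor
    · intro h
      exact ⟨S.toFinite.toFinset, mem_descendingLinkQV_faces.2
        ⟨by simpa using hS, by simpa using h.2⟩, by simp⟩
    · rintro ⟨s, hs, hSs⟩
      exact ⟨fun t _ => by simp [mem_vertsIn],
        (mem_descendingLinkQV_faces.1 hs).2.mono hSs⟩
  exact isNConnected_of_fill hconn.nonempty fun i hi => hconn _ (by simpa using by omega)
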